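/- For subspaces $V_1,\dots,V_n$ of a vector space over a finite field, let $h(\alpha)=\dim\langle V_i : i\in\alpha\rangle$ for $\alpha\subseteq\{1,\dots,n\}$. A function $h:2^{\{1,\dots,n\}}\to\mathbb{R}$ that arises in this way from finite-dimensional subspaces over $\mathbb{F}_q$ is called $q$-representable. It is even representable if it is $2^m$-representable for some integer $m\ge 1$, and odd representable if it is $p^m$-representable for some odd prime $p$ and some integer $m\ge 1$. A function $h:2^{\{1,\dots,n\}}\to\mathbb{R}$ is almost even (respectively almost odd) representable if there are even (respectively odd) representable functions $g_1,g_2,\dots$ on the same ground set and real numbers $c_i>0$ with $h=\lim_{i\to\infty}c_i g_i$ (pointwise); the field may vary with $i$. A matroid is identified with its rank function. Theorem. (1) Let $u_1,u_2,u_3$ be linearly independent vectors in a vector space over a finite field of characteristic $2$, and let $\Phi_1(\cdot)=\dim\langle\cdot\rangle$ be the rank function of the seven lines $$\langle u_1\rangle,\ \langle u_2\rangle,\ \langle u_3\rangle,\ \langle u_1+u_2\rangle,\ \langle u_2+u_3\rangle,\ \langle u_1+u_2+u_3\rangle,\ \langle u_1+u_3\rangle$$ (the Fano matroid). Then $\Phi_1$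 is a matroid that is even representable but not almost odd representable. (2) Let $u_1,\dots,u_5$ be linearly independent vectors in a vector space over a finite field of odd characteristic, and let $\Phi_2(\cdot)=\dim\langle\cdot\rangle$ be the rank function of the thirteen lines $$\langle u_1\rangle,\dots,\langle u_5\rangle,\ \langle u_1+u_2+u_3\rangle,\ \langle u_3+u_4+u_5\rangle,\ \langle u_1+u_2\rangle,\ \langle u_1+u_3\rangle,\ \langle u_2+u_3\rangle,\ \langle u_3+u_4\rangle,\ \langle u_3+u_5\rangle,\ \langle u_4+u_5\rangle .$$ Then $\Phi_2$ is a matroid that is odd representable but not almost even representable. -/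

import Mathlib

open Filter Topology

namespace SubspaceRank

/-- `h : 2^ι → ℝ` is the rank function of a polymatroid on the ground set `ι`. -/
structure IsPolymatroid {ι : Type*} [DecidableEq ι] (h : Finset ι → ℝ) : Prop where
  nonneg : ∀ A, 0 ≤ h A
  empty : h ∅ = 0
  mono : ∀ A B, A ⊆ B → h A ≤ h B
  submodular : ∀ A B, h (A ∪ B) + h (A ∩ B) ≤ h A + h B

/-- A matroid is an integer-valued polymatroid whose rank is bounded by the cardinality. -/
structure IsMatroid {ι : Type*} [DecidableEq ι] (h : Finset ι → ℝ) : Prop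
    extends IsPolymatroid h where
  le_card : ∀ A, h A ≤ (A.card : ℝ)
  integral : ∀ A, ∃ n : ℤ, h A = (n : ℝ)

/-- The rank function `A ↦ dim ⟨V_i : i ∈ A⟩` of an indexed family of subspaces. -/
noncomputable def subspaceRank {ι F W : Type*} [Field F] [AddCommGroup W] [Module F W]
    (V : ι → Submodule F W) (A : Finset ι) : ℝ :=
  (Module.finrank F ↥(⨆ i ∈ A, V i) : ℝ)

/-- `h` is `q`-representable: it is the rank function of a family of subspaces of a
(finite-dimensional) vector space over the field with `q` elements. -/
def IsQRepresentable {ι : Type*} (q : ℕ) (h : Finset ι → ℝ) : Prop :=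
  ∃ (F : Type) (_ : Field F) (_ : Finite F) (W : Type) (_ : AddCommGroup W) (_ : Module F W)
    (_ : FiniteDimensional F W) (V : ι → Submodule F W),
    Nat.card F = q ∧ ∀ A : Finset ι, h A = subspaceRank V A

/-- Representable over some finite field of characteristic two. -/
def IsEvenRepresentable {ι : Type*} (h : Finset ι → ℝ) : Prop :=
  ∃ m : ℕ, 0 < m ∧ IsQRepresentable (2 ^ m) h

/-- Representable over some finite field of odd characteristic. -/
def IsOddRepresentable {ι : Type*} (h : Finset ι → ℝ) : Prop :=
  ∃ p m : ℕ, p.Prime ∧ Odd p ∧ 0 < m ∧ IsQRepresentable (p ^ m) h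

/-- `h` is a limit of positive multiples of even representable rank functions. -/
def IsAlmostEvenRepresentable {ι : Type*} (h : Finset ι → ℝ) : Prop :=
  ∃ (g : ℕ → Finset ι → ℝ) (c : ℕ → ℝ), (∀ i, IsEvenRepresentable (g i)) ∧ (∀ i, 0 < c i) ∧
    Tendsto (fun i => c i • g i) atTop (𝓝 h)

/-- `h` is a limit of positive multiples of odd representable rank functions; the field may
vary along the sequence. -/
def IsAlmostOddRepresentable {ι : Type*} (h : Finset ι → ℝ) : Prop :=
  ∃ (g : ℕ → Finset ι → ℝ) (c : ℕ → ℝ), (∀ i, IsOddRepresentable (g i)) ∧ (∀ i, 0 < c i) ∧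
    Tendsto (fun i => c i • g i) atTop (𝓝 h)

/-- The seven vectors spanning `Y₁, Y₂, Y₃` (left) and `W₁, …, W₄` (right). -/
def vectors₁ {W : Type*} [AddCommGroup W] (u : Fin 3 → W) : Fin 3 ⊕ Fin 4 → W :=
  Sum.elim u ![u 0 + u 1, u 1 + u 2, u 0 + u 1 + u 2, u 0 + u 2]

/-- The thirteen vectors spanning `Z₁, …, Z₅` (left) and `V₁, …, V₈` (right). -/
def vectors₂ {W : Type*} [AddCommGroup W] (u : Fin 5 → W) : Fin 5 ⊕ Fin 8 → W :=
  Sum.elim u ![u 0 + u 1 + u 2, u 2 + u 3 + u 4, u 0 + u 1, u 0 + u 2, u 1 + u 2,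
    u 2 + u 3, u 2 + u 4, u 3 + u 4]

/-- The rank function of the lines `Y₁, Y₂, Y₃, W₁, …, W₄`. -/
noncomputable def Φ₁ (F : Type*) {W : Type*} [Field F] [AddCommGroup W] [Module F W]
    (u : Fin 3 → W) : Finset (Fin 3 ⊕ Fin 4) → ℝ :=
  subspaceRank fun x => Submodule.span F {vectors₁ u x}

/-- The rank function of the lines `Z₁, …, Z₅, V₁, …, V₈`. -/
noncomputable def Φ₂ (F : Type*) {W : Type*} [Field F] [AddCommGroup W] [Module F W]
    (u : Fin 5 → W) : Finset (Fin 5 ⊕ Fin 8) → ℝ :=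
  subspaceRank fun x => Submodule.span F {vectors₂ u x}

end SubspaceRank

/-! Both negative claims come from linear rank inequalities that depend on the characteristic. Given
subspaces `A, B, C, D, P, Q, R`, consider the triples `(x, y, z)` in `A × B × C` with `x + y + z ∈
D`, `x + y ∈ P`, `y + z ∈ Q`, `x + z ∈ R`. Over any field, `finrank_triples_ge` bounds their
dimension below by a rank expression.

The upper bound depends on `2`. If `2` is invertible, `2x = (x + y) + (x + z) - (y + z)` puts `x`,
and likewise `y` and `z`, in `P + Q + R`. In characteristic two, `x + z = (x + y) + (y + z)` lies in
`P + Q`. Comparing bounds gives `oddGap_nonneg` and `evenGap_nonneg`. The gaps are continuous and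
homogeneous, so the inequalities survive positive scaling and limits over varying fields.

On the lines of `x, y, z` and their sums the lower bound is at least `1`, while `x + y, y + z, x +
z` are collinear exactly in characteristic two; each gap is then at most `-1` in the opposite
characteristic. Both `Φ₁` and `Φ₂` contain such a configuration. -/

namespace SubspaceRank

open Module Submodule

/-! ### Dimension counts for images and preimages. -/

section Dimension

variable {F W W' : Type*} [Field F] [AddCommGroup W] [Module F W] [FiniteDimensional F W]
  [AddCommGroup W'] [Module F W']

theorem finrank_map_add_finrank_inf_ker (f : W →ₗ[F] W') (X : Submodule F W) :
    finrank F (X.map f) + finrank F ↥(X ⊓ LinearMap.ker f) = finrank F X := by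
  have h := LinearMap.finrank_range_add_finrank_ker (f.domRestrict X)
  rw [LinearMap.range_domRestrict, LinearMap.ker_domRestrict,
    ← finrank_map_subtype_eq, LinearMap.ker, map_comap_subtype] at h
  exact h

/-- Cutting `X` down to the preimage of `Y` keeps its intersection with the kernel, so only the
image shrinks, from `f(X)` to `f(X) ∩ Y`; the modular law measures that loss. -/
theorem finrank_add_le_finrank_inf_comap [FiniteDimensional F W'] (f : W →ₗ[F] W')
    (X : Submodule F W) (Y : Submodule F W') :
    finrank F X + finrank F Y ≤ finrank F ↥(X ⊓ Y.comap f) + finrank F ↥(X.map f ⊔ Y) := by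
  have h₁ := finrank_map_add_finrank_inf_ker f X
  have h₂ := finrank_map_add_finrank_inf_ker f (X ⊓ Y.comap f)
  have hmap : (X ⊓ Y.comap f).map f = X.map f ⊓ Y := by
    ext y
    constructor
    · rintro ⟨x, ⟨hx, hy⟩, rfl⟩
      exact ⟨⟨x, hx, rfl⟩, hy⟩
    · rintro ⟨⟨x, hx, rfl⟩, hy⟩
      exact ⟨x, ⟨hx, hy⟩, rfl⟩
  have hker : (X ⊓ Y.comap f) ⊓ LinearMap.ker f = X ⊓ LinearMap.ker f := by
    rw [inf_assoc, inf_eq_right.2 (LinearMap.ker_le_comap f)]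
  rw [hmap, hker] at h₂
  have h₃ := finrank_sup_add_finrank_inf_eq (X.map f) Y
  omega

theorem finrank_prod_eq [FiniteDimensional F W'] (X : Submodule F W) (Y : Submodule F W') :
    finrank F (X.prod Y) = finrank F X + finrank F Y := by
  have h : X.prod Y = LinearMap.range (X.subtype.prodMap Y.subtype) := by
    rw [LinearMap.range_prodMap, range_subtype, range_subtype]
  rw [h, LinearMap.finrank_range_of_inj
    (Prod.map_injective.2 ⟨X.injective_subtype, Y.injective_subtype⟩), finrank_prod]

end Dimension

/-! ### Upper and lower bounds for the space of triples. -/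

section Triples

variable {F W : Type*} [Field F] [AddCommGroup W] [Module F W]

/-- The triples `(x, y, z) ∈ A × B × C` with `x + y + z ∈ D`, `x + y ∈ P`, `y + z ∈ Q` and
`x + z ∈ R`. -/
def triples (A B C D P Q R : Submodule F W) : Submodule F (W × W × W) where
  carrier := {v | (v.1 ∈ A ∧ v.2.1 ∈ B ∧ v.2.2 ∈ C) ∧ v.1 + v.2.1 + v.2.2 ∈ D ∧
    v.1 + v.2.1 ∈ P ∧ v.2.1 + v.2.2 ∈ Q ∧ v.1 + v.2.2 ∈ R}
  zero_mem' := by simp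
  add_mem' := by
    rintro ⟨a, b, c⟩ ⟨a', b', c'⟩ ⟨⟨h₁, h₂, h₃⟩, h₄, h₅, h₆, h₇⟩ ⟨⟨k₁, k₂, k₃⟩, k₄, k₅, k₆, k₇⟩
    refine ⟨⟨add_mem h₁ k₁, add_mem h₂ k₂, add_mem h₃ k₃⟩, ?_, ?_, ?_, ?_⟩
    · convert add_mem h₄ k₄ using 1; simp only [Prod.mk_add_mk]; abel
    · convert add_mem h₅ k₅ using 1; simp only [Prod.mk_add_mk]; abel
    · convert add_mem h₆ k₆ using 1; simp only [Prod.mk_add_mk]; abel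
    · convert add_mem h₇ k₇ using 1; simp only [Prod.mk_add_mk]; abel
  smul_mem' := by
    rintro r ⟨a, b, c⟩ ⟨⟨h₁, h₂, h₃⟩, h₄, h₅, h₆, h₇⟩
    refine ⟨⟨smul_mem _ r h₁, smul_mem _ r h₂, smul_mem _ r h₃⟩, ?_, ?_, ?_, ?_⟩
    · simpa only [Prod.smul_mk, smul_add] using smul_mem _ r h₄
    · simpa only [Prod.smul_mk, smul_add] using smul_mem _ r h₅
    · simpa only [Prod.smul_mk, smul_add] using smul_mem _ r h₆
    · simpa only [Prod.smul_mk, smul_add] using smul_mem _ r h₇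

theorem mem_of_add_self_mem (h2 : (2 : F) ≠ 0) {S : Submodule F W} {x : W}
    (h : x + x ∈ S) : x ∈ S := by
  rw [← two_smul F] at h
  exact (S.smul_mem_iff h2).1 h

variable [FiniteDimensional F W]

/-- Cutting a space `X` of triples down to those whose image under `f` lies in `P` costs little
when all the images lie in `M ⊓ N` and `P` is nearly all of it. -/
theorem finrank_inf_comap_ge {W' : Type*} [AddCommGroup W'] [Module F W'] [FiniteDimensional F W']
    (f : W' →ₗ[F] W) (X : Submodule F W') (P M N E : Submodule F W)
    (hM : X.map f ≤ M) (hN : X.map f ≤ N) (hE : E ≤ M ⊔ N) :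
    (finrank F X : ℝ) + finrank F P + finrank F E ≤
      finrank F ↥(X ⊓ P.comap f) + finrank F ↥(M ⊔ P) + finrank F ↥(N ⊔ P) := by
  have h₁ := finrank_add_le_finrank_inf_comap f X P
  have h₂ : finrank F ↥(X.map f ⊔ P) ≤ finrank F ↥((M ⊔ P) ⊓ (N ⊔ P)) :=
    finrank_mono (le_inf (sup_le_sup_right hM P) (sup_le_sup_right hN P))
  have h₃ := finrank_sup_add_finrank_inf_eq (M ⊔ P) (N ⊔ P)
  have h₄ : finrank F E ≤ finrank F ↥((M ⊔ P) ⊔ (N ⊔ P)) :=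
    finrank_mono (hE.trans (sup_le_sup le_sup_left le_sup_left))
  exact_mod_cast (by omega : finrank F X + finrank F P + finrank F E ≤
      finrank F ↥(X ⊓ P.comap f) + finrank F ↥(M ⊔ P) + finrank F ↥(N ⊔ P))

/-- The conditions are imposed one at a time. `D` comes first: once `x + y + z ∈ D`, each pair sum
is also this total minus the third entry, so `x + y` lies in both `D + C` and `A + B`, and similarly
for the others. -/
theorem finrank_triples_ge (A B C D P Q R : Submodule F W) :
    (finrank F A : ℝ) + finrank F B + finrank F C + finrank F D - finrank F ↥(A ⊔ B ⊔ C ⊔ D) +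
      (finrank F P + finrank F ↥(A ⊔ B ⊔ C) - finrank F ↥(D ⊔ C ⊔ P) - finrank F ↥(A ⊔ B ⊔ P)) +
      (finrank F Q + finrank F ↥(A ⊔ B ⊔ C) - finrank F ↥(D ⊔ A ⊔ Q) - finrank F ↥(B ⊔ C ⊔ Q)) +
      (finrank F R + finrank F ↥(A ⊔ B ⊔ C) - finrank F ↥(D ⊔ B ⊔ R) - finrank F ↥(A ⊔ C ⊔ R)) ≤
    finrank F (triples A B C D P Q R) := by
  let x : W × W × W →ₗ[F] W := LinearMap.fst F W (W × W)
  let y : W × W × W →ₗ[F] W := LinearMap.fst F W W ∘ₗ LinearMap.snd F W (W × W)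
  let z : W × W × W →ₗ[F] W := LinearMap.snd F W W ∘ₗ LinearMap.snd F W (W × W)
  let X₀ := A.prod (B.prod C)
  let X₁ := X₀ ⊓ D.comap (x + y + z)
  let X₂ := X₁ ⊓ P.comap (x + y)
  let X₃ := X₂ ⊓ Q.comap (y + z)
  have hX : X₃ ⊓ R.comap (x + z) ≤ triples A B C D P Q R := by
    rintro ⟨a, b, c⟩ ⟨⟨⟨⟨⟨h₁, h₂, h₃⟩, h₄⟩, h₅⟩, h₆⟩, h₇⟩
    exact ⟨⟨h₁, h₂, h₃⟩, h₄, h₅, h₆, h₇⟩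
  have hX₁ : ∀ {a b c : W}, (a, b, c) ∈ X₁ → (a ∈ A ∧ b ∈ B ∧ c ∈ C) ∧ a + b + c ∈ D :=
    fun h => ⟨h.1, h.2⟩
  have e₀ : finrank F X₀ = finrank F A + (finrank F B + finrank F C) := by
    rw [finrank_prod_eq, finrank_prod_eq]
  have e₁ : finrank F X₀ + finrank F D ≤ finrank F X₁ + finrank F ↥(X₀.map (x + y + z) ⊔ D) :=
    finrank_add_le_finrank_inf_comap (x + y + z) X₀ D
  have e₂ : finrank F ↥(X₀.map (x + y + z) ⊔ D) ≤ finrank F ↥(A ⊔ B ⊔ C ⊔ D) := by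
    refine finrank_mono (sup_le_sup_right ?_ D)
    rintro _ ⟨⟨a, b, c⟩, ⟨ha, hb, hc⟩, rfl⟩
    exact add_mem_sup (add_mem_sup ha hb) hc
  have e₃ : (finrank F A : ℝ) + finrank F B + finrank F C + finrank F D ≤
      finrank F X₁ + finrank F ↥(A ⊔ B ⊔ C ⊔ D) := by
    exact_mod_cast (by omega : finrank F A + finrank F B + finrank F C + finrank F D ≤
      finrank F X₁ + finrank F ↥(A ⊔ B ⊔ C ⊔ D))
  have e₄ := finrank_inf_comap_ge (x + y) X₁ P (D ⊔ C) (A ⊔ B) (A ⊔ B ⊔ C)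
    (by
      rintro _ ⟨⟨a, b, c⟩, h, rfl⟩
      have h' := sub_mem (le_sup_left (b := C) (hX₁ h).2) (le_sup_right (a := D) (hX₁ h).1.2.2)
      rwa [add_sub_cancel_right] at h')
    (by
      rintro _ ⟨⟨a, b, c⟩, h, rfl⟩
      exact add_mem_sup (hX₁ h).1.1 (hX₁ h).1.2.1)
    (sup_le le_sup_right (le_sup_of_le_left le_sup_right))
  have e₅ := finrank_inf_comap_ge (y + z) X₂ Q (D ⊔ A) (B ⊔ C) (A ⊔ B ⊔ C)
    (by
      rintro _ ⟨⟨a, b, c⟩, ⟨h, -⟩, rfl⟩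
      have h' := sub_mem (le_sup_left (b := A) (hX₁ h).2) (le_sup_right (a := D) (hX₁ h).1.1)
      rwa [add_assoc, add_sub_cancel_left] at h')
    (by
      rintro _ ⟨⟨a, b, c⟩, ⟨h, -⟩, rfl⟩
      exact add_mem_sup (hX₁ h).1.2.1 (hX₁ h).1.2.2)
    (by
      rw [sup_assoc]
      exact sup_le_sup_right le_sup_right _)
  have e₆ := finrank_inf_comap_ge (x + z) X₃ R (D ⊔ B) (A ⊔ C) (A ⊔ B ⊔ C)
    (by
      rintro _ ⟨⟨a, b, c⟩, ⟨⟨h, -⟩, -⟩, rfl⟩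
      have h' := sub_mem (le_sup_left (b := B) (hX₁ h).2) (le_sup_right (a := D) (hX₁ h).1.2.1)
      rwa [add_right_comm, add_sub_cancel_right] at h')
    (by
      rintro _ ⟨⟨a, b, c⟩, ⟨⟨h, -⟩, -⟩, rfl⟩
      exact add_mem_sup (hX₁ h).1.1 (hX₁ h).1.2.2)
    (by
      rw [sup_right_comm, sup_comm]
      exact sup_le_sup_right le_sup_right _)
  have e₇ : (finrank F ↥(X₃ ⊓ R.comap (x + z)) : ℝ) ≤ finrank F (triples A B C D P Q R) := by
    exact_mod_cast finrank_mono hX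
  change _ ≤ (finrank F X₂ : ℝ) + _ + _ at e₄
  change _ ≤ (finrank F X₃ : ℝ) + _ + _ at e₅
  linarith

/-- A linear map on triples whose values lie in `M` and whose kernel is covered by the image of
`K × L` has at least `dim T - dim K - dim L` dimensions of values in `M`. -/
theorem finrank_triples_le {T : Submodule F (W × W × W)} {f : W × W × W →ₗ[F] W}
    {φ : W × W →ₗ[F] W × W × W} {M K L : Submodule F W} (hM : T.map f ≤ M)
    (hφ : T ⊓ LinearMap.ker f ≤ (K.prod L).map φ) :
    (finrank F T : ℝ) ≤ finrank F M + finrank F K + finrank F L := by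
  have h₁ := finrank_map_add_finrank_inf_ker f T
  have h₂ := finrank_mono hM
  have h₃ := (finrank_mono hφ).trans (finrank_map_le φ _)
  rw [finrank_prod_eq] at h₃
  exact_mod_cast (by omega : finrank F T ≤ finrank F M + finrank F K + finrank F L)

theorem finrank_inf_eq (A B : Submodule F W) :
    (finrank F ↥(A ⊓ B) : ℝ) = finrank F A + finrank F B - finrank F ↥(A ⊔ B) := by
  rw [eq_sub_iff_add_eq']
  exact_mod_cast finrank_sup_add_finrank_inf_eq A B

/-- Modulo `S`, the images of `A, B, C` have dimensions `dim A - dim (A ∩ S)` and so on, and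
together they span at least `dim (A + B + C) - dim S`. -/
theorem finrank_sup_triple_le (S A B C : Submodule F W) :
    (finrank F ↥(A ⊔ B ⊔ C) : ℝ) + finrank F ↥(A ⊓ S) + finrank F ↥(B ⊓ S) + finrank F ↥(C ⊓ S) ≤
      finrank F S + finrank F A + finrank F B + finrank F C := by
  have hA := finrank_sup_add_finrank_inf_eq A S
  have hB := finrank_sup_add_finrank_inf_eq B S
  have hC := finrank_sup_add_finrank_inf_eq C S
  have h₁ := finrank_sup_add_finrank_inf_eq (A ⊔ S) (B ⊔ S)
  have h₂ := finrank_sup_add_finrank_inf_eq ((A ⊔ S) ⊔ (B ⊔ S)) (C ⊔ S)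
  have h₃ : finrank F S ≤ finrank F ↥((A ⊔ S) ⊓ (B ⊔ S)) :=
    finrank_mono (le_inf le_sup_right le_sup_right)
  have h₄ : finrank F S ≤ finrank F ↥(((A ⊔ S) ⊔ (B ⊔ S)) ⊓ (C ⊔ S)) :=
    finrank_mono (le_inf (le_sup_of_le_left le_sup_right) le_sup_right)
  have h₅ : finrank F ↥(A ⊔ B ⊔ C) ≤ finrank F ↥((A ⊔ S) ⊔ (B ⊔ S) ⊔ (C ⊔ S)) :=
    finrank_mono (sup_le_sup (sup_le_sup le_sup_left le_sup_left) le_sup_left)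
  exact_mod_cast (by omega : finrank F ↥(A ⊔ B ⊔ C) + finrank F ↥(A ⊓ S) + finrank F ↥(B ⊓ S) +
    finrank F ↥(C ⊓ S) ≤ finrank F S + finrank F A + finrank F B + finrank F C)

/-- Each coordinate projection takes values in `S = P + Q + R`, since twice a coordinate is a signed
sum of the pair sums. If `x = 0`, then `y ∈ B ∩ P` and `z ∈ C ∩ R`, which bounds the kernel. The
three bounds are added. -/
theorem three_mul_finrank_triples_le (h2 : (2 : F) ≠ 0) (A B C D P Q R : Submodule F W) :
    3 * (finrank F (triples A B C D P Q R) : ℝ) + finrank F ↥(A ⊔ B ⊔ C) ≤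
      finrank F ↥(P ⊔ Q ⊔ R) + finrank F A + finrank F B + finrank F C +
      finrank F ↥(B ⊓ P) + finrank F ↥(C ⊓ R) + finrank F ↥(A ⊓ P) + finrank F ↥(C ⊓ Q) +
      finrank F ↥(A ⊓ R) + finrank F ↥(B ⊓ Q) := by
  set T := triples A B C D P Q R
  set S := P ⊔ Q ⊔ R
  have hP : P ≤ S := le_sup_of_le_left le_sup_left
  have hQ : Q ≤ S := le_sup_of_le_left le_sup_right
  have hR : R ≤ S := le_sup_right
  let i₁ := LinearMap.inl F W (W × W)
  let i₂ := LinearMap.inr F W (W × W) ∘ₗ LinearMap.inl F W W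
  let i₃ := LinearMap.inr F W (W × W) ∘ₗ LinearMap.inr F W W
  have hA : (finrank F T : ℝ) ≤ finrank F ↥(A ⊓ S) + finrank F ↥(B ⊓ P) + finrank F ↥(C ⊓ R) := by
    refine finrank_triples_le (f := LinearMap.fst F W (W × W)) (φ := i₂.coprod i₃) ?_ ?_
    · rintro _ ⟨⟨a, b, c⟩, ⟨⟨ha, hb, hc⟩, -, hp, hq, hr⟩, rfl⟩
      refine ⟨ha, mem_of_add_self_mem h2 ?_⟩
      convert sub_mem (add_mem (hP hp) (hR hr)) (hQ hq) using 1
      simp only [LinearMap.fst_apply]; abel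
    · rintro ⟨a, b, c⟩ ⟨⟨⟨ha, hb, hc⟩, -, hp, hq, hr⟩, rfl : a = 0⟩
      simp only [zero_add] at hp hr
      exact ⟨(b, c), ⟨⟨hb, hp⟩, ⟨hc, hr⟩⟩, by simp [i₂, i₃]⟩
  have hB : (finrank F T : ℝ) ≤ finrank F ↥(B ⊓ S) + finrank F ↥(A ⊓ P) + finrank F ↥(C ⊓ Q) := by
    refine finrank_triples_le (f := LinearMap.fst F W W ∘ₗ LinearMap.snd F W (W × W))
      (φ := i₁.coprod i₃) ?_ ?_
    · rintro _ ⟨⟨a, b, c⟩, ⟨⟨ha, hb, hc⟩, -, hp, hq, hr⟩, rfl⟩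
      refine ⟨hb, mem_of_add_self_mem h2 ?_⟩
      convert sub_mem (add_mem (hP hp) (hQ hq)) (hR hr) using 1
      simp only [LinearMap.comp_apply, LinearMap.fst_apply, LinearMap.snd_apply]; abel
    · rintro ⟨a, b, c⟩ ⟨⟨⟨ha, hb, hc⟩, -, hp, hq, hr⟩, rfl : b = 0⟩
      simp only [zero_add, add_zero] at hp hq
      exact ⟨(a, c), ⟨⟨ha, hp⟩, ⟨hc, hq⟩⟩, by simp [i₁, i₃]⟩
  have hC : (finrank F T : ℝ) ≤ finrank F ↥(C ⊓ S) + finrank F ↥(A ⊓ R) + finrank F ↥(B ⊓ Q) := by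
    refine finrank_triples_le (f := LinearMap.snd F W W ∘ₗ LinearMap.snd F W (W × W))
      (φ := i₁.coprod i₂) ?_ ?_
    · rintro _ ⟨⟨a, b, c⟩, ⟨⟨ha, hb, hc⟩, -, hp, hq, hr⟩, rfl⟩
      refine ⟨hc, mem_of_add_self_mem h2 ?_⟩
      convert sub_mem (add_mem (hQ hq) (hR hr)) (hP hp) using 1
      simp only [LinearMap.comp_apply, LinearMap.snd_apply]; abel
    · rintro ⟨a, b, c⟩ ⟨⟨⟨ha, hb, hc⟩, -, hp, hq, hr⟩, rfl : c = 0⟩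
      simp only [add_zero] at hq hr
      exact ⟨(a, b), ⟨⟨ha, hr⟩, ⟨hb, hq⟩⟩, by simp [i₁, i₂]⟩
  have hS := finrank_sup_triple_le S A B C
  linarith

theorem finrank_triples_le_of_charP_two [CharP F 2] (A B C D P Q R : Submodule F W) :
    (finrank F (triples A B C D P Q R) : ℝ) ≤
      finrank F ↥(R ⊓ (P ⊔ Q)) + finrank F ↥(A ⊓ C) + finrank F ↥(B ⊓ D) := by
  have h2 (x : W) : x + x = 0 := by
    rw [← two_smul F, CharTwo.two_eq_zero, zero_smul]
  let x := LinearMap.fst F W (W × W)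
  let z := LinearMap.snd F W W ∘ₗ LinearMap.snd F W (W × W)
  -- The kernel of `x + z` consists of triples `(a, b, -a)`, whose total is `b`; hence `a ∈ A ∩ C`
  -- and `b ∈ B ∩ D`.
  let φ : W × W →ₗ[F] W × W × W :=
    (LinearMap.fst F W W).prod ((LinearMap.snd F W W).prod (-LinearMap.fst F W W))
  refine finrank_triples_le (f := x + z) (φ := φ) ?_ ?_
  · rintro _ ⟨⟨a, b, c⟩, ⟨⟨ha, hb, hc⟩, -, hp, hq, hr⟩, rfl⟩
    refine ⟨hr, ?_⟩
    have h : a + b + (b + c) = a + c := by rw [add_assoc, ← add_assoc b, h2, zero_add]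
    change a + c ∈ P ⊔ Q
    exact h ▸ add_mem_sup hp hq
  · rintro ⟨a, b, c⟩ ⟨⟨⟨ha, hb, hc⟩, hd, -⟩, hac : a + c = 0⟩
    obtain rfl : c = -a := eq_neg_of_add_eq_zero_right hac
    refine ⟨(a, b), ⟨⟨ha, by simpa using hc⟩, ⟨hb, ?_⟩⟩, rfl⟩
    simpa using hd

end Triples

/-! ### Rank inequalities and their passage to limits. -/

section Inequalities

theorem subspaceRank_singleton {ι F W : Type*} [Field F] [AddCommGroup W] [Module F W]
    (V : ι → Submodule F W) (a : ι) : subspaceRank V {a} = finrank F (V a) := by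
  rw [subspaceRank, Finset.iSup_singleton]

variable {ι : Type*} [DecidableEq ι]

/-- The rank expression bounding the dimension of `triples` from below. -/
def tripleBound (h : Finset ι → ℝ) (a b c d p q r : ι) : ℝ :=
  h {a} + h {b} + h {c} + h {d} - h {a, b, c, d} +
    (h {p} + h {a, b, c} - h {d, c, p} - h {a, b, p}) +
    (h {q} + h {a, b, c} - h {d, a, q} - h {b, c, q}) +
    (h {r} + h {a, b, c} - h {d, b, r} - h {a, c, r})

/-- The rank expression for the dimension of the intersection of two members of the family. -/
def overlap (h : Finset ι → ℝ) (a b : ι) : ℝ :=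
  h {a} + h {b} - h {a, b}

/-- A rank expression that is nonnegative on families of subspaces in characteristic not two. -/
def oddGap (h : Finset ι → ℝ) (a b c d p q r : ι) : ℝ :=
  h {p, q, r} + h {a} + h {b} + h {c} - h {a, b, c} - 3 * tripleBound h a b c d p q r +
    overlap h b p + overlap h c r + overlap h a p + overlap h c q + overlap h a r + overlap h b q

/-- A rank expression that is nonnegative on families of subspaces in characteristic two. -/
def evenGap (h : Finset ι → ℝ) (a b c d p q r : ι) : ℝ :=
  h {r} + h {p, q} - h {p, q, r} - tripleBound h a b c d p q r + overlap h a c + overlap h b d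

theorem oddGap_smul (s : ℝ) (h : Finset ι → ℝ) (a b c d p q r : ι) :
    oddGap (s • h) a b c d p q r = s * oddGap h a b c d p q r := by
  simp only [oddGap, tripleBound, overlap, Pi.smul_apply, smul_eq_mul]
  ring

theorem evenGap_smul (s : ℝ) (h : Finset ι → ℝ) (a b c d p q r : ι) :
    evenGap (s • h) a b c d p q r = s * evenGap h a b c d p q r := by
  simp only [evenGap, tripleBound, overlap, Pi.smul_apply, smul_eq_mul]
  ring

theorem continuous_oddGap (a b c d p q r : ι) :
    Continuous fun h : Finset ι → ℝ => oddGap h a b c d p q r := by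
  unfold oddGap tripleBound overlap
  fun_prop

theorem continuous_evenGap (a b c d p q r : ι) :
    Continuous fun h : Finset ι → ℝ => evenGap h a b c d p q r := by
  unfold evenGap tripleBound overlap
  fun_prop

section Family

variable {F W : Type*} [Field F] [AddCommGroup W] [Module F W] (V : ι → Submodule F W)

theorem subspaceRank_pair (a b : ι) : subspaceRank V {a, b} = finrank F ↥(V a ⊔ V b) := by
  rw [subspaceRank, Finset.iSup_insert, Finset.iSup_singleton]

theorem subspaceRank_triple (a b c : ι) :
    subspaceRank V {a, b, c} = finrank F ↥(V a ⊔ V b ⊔ V c) := by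
  rw [subspaceRank, Finset.iSup_insert, Finset.iSup_insert, Finset.iSup_singleton, sup_assoc]

theorem subspaceRank_quadruple (a b c d : ι) :
    subspaceRank V {a, b, c, d} = finrank F ↥(V a ⊔ V b ⊔ V c ⊔ V d) := by
  rw [subspaceRank, Finset.iSup_insert, Finset.iSup_insert, Finset.iSup_insert,
    Finset.iSup_singleton, sup_assoc, sup_assoc]

variable [FiniteDimensional F W]

theorem overlap_subspaceRank (a b : ι) :
    overlap (subspaceRank V) a b = finrank F ↥(V a ⊓ V b) := by
  rw [overlap, subspaceRank_singleton, subspaceRank_singleton, subspaceRank_pair, finrank_inf_eq]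

theorem tripleBound_le (a b c d p q r : ι) :
    tripleBound (subspaceRank V) a b c d p q r ≤
      finrank F (triples (V a) (V b) (V c) (V d) (V p) (V q) (V r)) := by
  simp only [tripleBound, subspaceRank_singleton, subspaceRank_triple, subspaceRank_quadruple]
  exact finrank_triples_ge _ _ _ _ _ _ _

theorem oddGap_nonneg (h2 : (2 : F) ≠ 0) (a b c d p q r : ι) :
    0 ≤ oddGap (subspaceRank V) a b c d p q r := by
  have h₁ := tripleBound_le V a b c d p q r
  have h₂ := three_mul_finrank_triples_le h2 (V a) (V b) (V c) (V d) (V p) (V q) (V r)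
  simp only [oddGap, overlap_subspaceRank, subspaceRank_triple, subspaceRank_singleton]
  linarith

theorem evenGap_nonneg [CharP F 2] (a b c d p q r : ι) :
    0 ≤ evenGap (subspaceRank V) a b c d p q r := by
  have h₁ := tripleBound_le V a b c d p q r
  have h₂ := finrank_triples_le_of_charP_two (V a) (V b) (V c) (V d) (V p) (V q) (V r)
  rw [finrank_inf_eq, sup_comm (V r)] at h₂
  simp only [evenGap, overlap_subspaceRank, subspaceRank_triple, subspaceRank_singleton,
    subspaceRank_pair]
  linarith

end Family

theorem IsAlmostOddRepresentable.oddGap_nonneg {h : Finset ι → ℝ}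
    (hh : IsAlmostOddRepresentable h) (a b c d p q r : ι) : 0 ≤ oddGap h a b c d p q r := by
  obtain ⟨g, s, hg, hs, hlim⟩ := hh
  refine ge_of_tendsto' (((continuous_oddGap a b c d p q r).tendsto h).comp hlim) fun i => ?_
  obtain ⟨l, m, hl, hodd, hm, F, _, _, W, _, _, _, V, hcard, hV⟩ := hg i
  rw [Function.comp_apply, oddGap_smul, show g i = subspaceRank V from funext hV]
  refine mul_nonneg (hs i).le (SubspaceRank.oddGap_nonneg V (fun h2 => ?_) a b c d p q r)
  -- If `2 = 0`, the additive order of `1` divides both `2` and the odd cardinality of the field,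
  -- forcing `1 = 0`.
  have hdvd : addOrderOf (1 : F) ∣ 2 := addOrderOf_dvd_of_nsmul_eq_zero (by simpa using h2)
  have hdvd' : addOrderOf (1 : F) ∣ l ^ m := hcard ▸ addOrderOf_dvd_natCard (1 : F)
  have hcop : Nat.Coprime 2 (l ^ m) := (Nat.coprime_two_left.2 hodd).pow_right m
  have h1 := Nat.dvd_gcd hdvd hdvd'
  rw [hcop.gcd_eq_one, Nat.dvd_one, AddMonoid.addOrderOf_eq_one_iff] at h1
  exact one_ne_zero h1

theorem IsAlmostEvenRepresentable.evenGap_nonneg {h : Finset ι → ℝ}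
    (hh : IsAlmostEvenRepresentable h) (a b c d p q r : ι) : 0 ≤ evenGap h a b c d p q r := by
  obtain ⟨g, s, hg, hs, hlim⟩ := hh
  refine ge_of_tendsto' (((continuous_evenGap a b c d p q r).tendsto h).comp hlim) fun i => ?_
  obtain ⟨m, hm, F, _, _, W, _, _, _, V, hcard, hV⟩ := hg i
  rw [Function.comp_apply, evenGap_smul, show g i = subspaceRank V from funext hV]
  have h2 : (2 : F) = 0 := by
    have h : ((2 ^ m : ℕ) : F) = 0 := by
      have := Fintype.ofFinite F
      rw [← hcard, Nat.card_eq_fintype_card, Nat.cast_card_eq_zero]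
    exact pow_eq_zero_iff hm.ne' |>.1 (by exact_mod_cast h)
  have : CharP F 2 := CharTwo.of_one_ne_zero_of_two_eq_zero one_ne_zero h2
  exact mul_nonneg (hs i).le (SubspaceRank.evenGap_nonneg V a b c d p q r)

end Inequalities

/-! ### Representability and the matroid axioms. -/

section Representable

variable {ι F W : Type*} [Field F] [AddCommGroup W] [Module F W]

/-- Representability asks for a field and a space in `Type`; finite ones in any universe have such
copies, and ranks transfer along the semilinear equivalence. -/
theorem isQRepresentable_of_finiteDimensional [Finite F] [FiniteDimensional F W]
    (V : ι → Submodule F W) : IsQRepresentable (Nat.card F) (subspaceRank V) := by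
  have : Finite W := Module.finite_of_finite F
  let e : F ≃+* Shrink.{0} F := (Shrink.ringEquiv.{0} F).symm
  let _ : Module (Shrink.{0} F) W := Module.compHom W (e.symm : Shrink.{0} F →+* F)
  let σ : F →+* Shrink.{0} F := e
  let σ' : Shrink.{0} F →+* F := e.symm
  have : RingHomInvPair σ σ' := RingHomInvPair.of_ringEquiv e
  have : RingHomInvPair σ' σ := RingHomInvPair.of_ringEquiv e.symm
  let f : W ≃ₛₗ[σ] Shrink.{0} W :=
    { (Shrink.addEquiv.{0} (α := W)).symm with
      map_smul' := fun r x => by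
        have h : r • x = e r • x := by
          change r • x = e.symm (e r) • x
          rw [e.symm_apply_apply]
        change (equivShrink.{0} W) (r • x) = e r • (equivShrink.{0} W) x
        rw [h, equivShrink_smul] }
  have : Finite (Shrink.{0} W) := Finite.of_equiv W (equivShrink.{0} W)
  refine ⟨Shrink.{0} F, inferInstance, Finite.of_equiv F (equivShrink.{0} F), Shrink.{0} W,
    inferInstance, inferInstance, inferInstance, fun i => (V i).map (f : W →ₛₗ[σ] Shrink.{0} W),
    (Nat.card_congr (equivShrink.{0} F)).symm, fun A => ?_⟩
  have hmap : ⨆ i ∈ A, (V i).map (f : W →ₛₗ[σ] Shrink.{0} W) =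
      (⨆ i ∈ A, V i).map (f : W →ₛₗ[σ] Shrink.{0} W) := by
    simp only [Submodule.map_iSup]
  rw [subspaceRank, subspaceRank, hmap]
  let j := f.submoduleMap (⨆ i ∈ A, V i)
  have h := lift_rank_eq_of_equiv_equiv σ j.toAddEquiv e.bijective fun r m => j.map_smulₛₗ r m
  have h' := congrArg Cardinal.toNat h
  rw [Cardinal.toNat_lift, Cardinal.toNat_lift] at h'
  exact_mod_cast h'

/-- The ambient space may be infinite-dimensional, so it is replaced by the span of the family. -/
theorem isQRepresentable_subspaceRank [Finite F] [Finite ι] (V : ι → Submodule F W)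
    [∀ i, FiniteDimensional F (V i)] : IsQRepresentable (Nat.card F) (subspaceRank V) := by
  convert isQRepresentable_of_finiteDimensional (fun i => (V i).comap (⨆ i, V i).subtype) using 1
  funext A
  rw [subspaceRank, subspaceRank, ← finrank_map_subtype_eq]
  have h : (⨆ i ∈ A, (V i).comap (⨆ i, V i).subtype).map (⨆ i, V i).subtype = ⨆ i ∈ A, V i := by
    simp only [Submodule.map_iSup, map_comap_subtype, inf_eq_right.2 (le_iSup V _)]
  rw [h]

theorem iSup_span_singleton_eq (v : ι → W) (A : Finset ι) :
    ⨆ i ∈ A, span F {v i} = span F (Set.image v A) := by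
  rw [← span_iUnion₂]
  congr 1
  ext
  simp [eq_comm]

instance finiteDimensional_iSup_span_singleton (v : ι → W) (A : Finset ι) :
    FiniteDimensional F ↥(⨆ i ∈ A, span F {v i}) := by
  rw [iSup_span_singleton_eq]
  exact FiniteDimensional.span_of_finite F (A.finite_toSet.image v)

theorem isMatroid_subspaceRank_span_singleton [DecidableEq ι] (v : ι → W) :
    IsMatroid (subspaceRank fun i => span F {v i}) where
  nonneg A := Nat.cast_nonneg _
  empty := by
    rw [subspaceRank, iSup_span_singleton_eq, Finset.coe_empty, Set.image_empty, span_empty,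
      finrank_bot, Nat.cast_zero]
  mono A B h := by
    simp only [subspaceRank]
    exact_mod_cast finrank_mono (biSup_mono fun i hi => h hi)
  submodular A B := by
    simp only [subspaceRank]
    have h₁ := finrank_sup_add_finrank_inf_eq (⨆ i ∈ A, span F {v i}) (⨆ i ∈ B, span F {v i})
    have h₂ : finrank F ↥(⨆ i ∈ A ∩ B, span F {v i}) ≤
        finrank F ↥((⨆ i ∈ A, span F {v i}) ⊓ ⨆ i ∈ B, span F {v i}) :=
      finrank_mono (le_inf (biSup_mono fun i hi => (Finset.mem_inter.1 hi).1)
        (biSup_mono fun i hi => (Finset.mem_inter.1 hi).2))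
    rw [Finset.iSup_union]
    exact_mod_cast (by omega)
  le_card A := by
    classical
    simp only [subspaceRank]
    have h : ⨆ i ∈ A, span F {v i} = span F ((A.image v : Finset W) : Set W) := by
      rw [Finset.coe_image, iSup_span_singleton_eq]
    rw [h]
    exact_mod_cast (finrank_span_finset_le_card _).trans Finset.card_image_le
  integral A := ⟨_, (Int.cast_natCast _).symm⟩

end Representable

/-! ### Ranks of small sets of lines. -/

section Lines

variable {ι F W : Type*} [Field F] [AddCommGroup W] [Module F W] {v : ι → W}

theorem subspaceRank_lines_singleton {a : ι} (ha : v a ≠ 0) :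
    subspaceRank (fun i => span F {v i}) {a} = 1 := by
  rw [subspaceRank_singleton, finrank_span_singleton ha, Nat.cast_one]

variable [DecidableEq ι]

theorem subspaceRank_lines_pair {a b : ι}
    (h : ∀ s t : F, s • v a + t • v b = 0 → s = 0 ∧ t = 0) :
    subspaceRank (fun i => span F {v i}) {a, b} = 2 := by
  have := finrank_span_eq_card (LinearIndependent.pair_iff.2 h)
  rw [Matrix.range_cons_cons_empty, span_insert] at this
  rw [subspaceRank_pair, this, Fintype.card_fin, Nat.cast_two]

theorem subspaceRank_lines_triple {a b c : ι}
    (h : ∀ r s t : F, r • v a + s • v b + t • v c = 0 → r = 0 ∧ s = 0 ∧ t = 0) :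
    subspaceRank (fun i => span F {v i}) {a, b, c} = 3 := by
  have hli : LinearIndependent F ![v a, v b, v c] := by
    rw [Fintype.linearIndependent_iff]
    intro g hg i
    have := h (g 0) (g 1) (g 2) (by simpa [Fin.sum_univ_three] using hg)
    fin_cases i <;> simp [this]
  have := finrank_span_eq_card hli
  have hr : Set.range ![v a, v b, v c] = {v a, v b, v c} := by
    rw [Matrix.range_cons, Matrix.range_cons_cons_empty, Set.singleton_union]
  rw [hr, span_insert, span_insert, ← sup_assoc] at this
  rw [subspaceRank_triple, this, Fintype.card_fin]
  norm_num

theorem subspaceRank_lines_insert {A : Finset ι} {c : ι} (h : v c ∈ span F (Set.image v A)) :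
    subspaceRank (fun i => span F {v i}) (insert c A) = subspaceRank (fun i => span F {v i}) A := by
  rw [subspaceRank, subspaceRank, Finset.iSup_insert, sup_eq_right.2]
  rwa [iSup_span_singleton_eq, span_singleton_le_iff_mem]

theorem subspaceRank_lines_collinear {a b c : ι} (h : v c ∈ span F {v a, v b}) :
    subspaceRank (fun i => span F {v i}) {a, b, c} ≤ 2 := by
  have hM := isMatroid_subspaceRank_span_singleton (F := F) v
  have e : ({a, b, c} : Finset ι) = insert c {a, b} := by
    ext; simp only [Finset.mem_insert, Finset.mem_singleton]; tauto
  rw [e, subspaceRank_lines_insert (by simpa [Set.image_pair] using h)]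
  exact (hM.le_card _).trans (by exact_mod_cast Finset.card_le_two)

end Lines

/-! ### Evaluating the gaps on the lines of a three-vector frame. -/

section Frame

variable {ι F W : Type*} [DecidableEq ι] [Field F] [AddCommGroup W] [Module F W] {v : ι → W}
  {x y z : W} {a b c d p q r : ι}

/-- The first five terms give `4 - 3`; each bracket is at least `1 + 3 - 2 - 2 = 0` by collinearity.
-/
theorem one_le_tripleBound_lines
    (hind : ∀ r s t : F, r • x + s • y + t • z = 0 → r = 0 ∧ s = 0 ∧ t = 0)
    (ha : v a = x) (hb : v b = y) (hc : v c = z) (hd : v d = x + y + z) (hp : v p = x + y)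
    (hq : v q = y + z) (hr : v r = x + z) :
    1 ≤ tripleBound (subspaceRank fun i => span F {v i}) a b c d p q r := by
  have hne (r s t : F) (h : r = 1 ∨ s = 1 ∨ t = 1) : r • x + s • y + t • z ≠ 0 := fun h0 => by
    obtain ⟨rfl, rfl, rfl⟩ := hind r s t h0
    simp at h
  have sa : subspaceRank (fun i => span F {v i}) {a} = 1 :=
    subspaceRank_lines_singleton (by simpa [ha] using hne 1 0 0 (by simp))
  have sb : subspaceRank (fun i => span F {v i}) {b} = 1 :=
    subspaceRank_lines_singleton (by simpa [hb] using hne 0 1 0 (by simp))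
  have sc : subspaceRank (fun i => span F {v i}) {c} = 1 :=
    subspaceRank_lines_singleton (by simpa [hc] using hne 0 0 1 (by simp))
  have sd : subspaceRank (fun i => span F {v i}) {d} = 1 :=
    subspaceRank_lines_singleton (by simpa [hd] using hne 1 1 1 (by simp))
  have sp : subspaceRank (fun i => span F {v i}) {p} = 1 :=
    subspaceRank_lines_singleton (by simpa [hp] using hne 1 1 0 (by simp))
  have sq : subspaceRank (fun i => span F {v i}) {q} = 1 :=
    subspaceRank_lines_singleton (by simpa [hq] using hne 0 1 1 (by simp))
  have sr : subspaceRank (fun i => span F {v i}) {r} = 1 :=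
    subspaceRank_lines_singleton (by simpa [hr] using hne 1 0 1 (by simp))
  have habc : subspaceRank (fun i => span F {v i}) {a, b, c} = 3 :=
    subspaceRank_lines_triple (by rwa [ha, hb, hc])
  have habcd : subspaceRank (fun i => span F {v i}) {a, b, c, d} = 3 := by
    have e : ({a, b, c, d} : Finset ι) = insert d {a, b, c} := by
      ext; simp only [Finset.mem_insert, Finset.mem_singleton]; tauto
    rw [e, subspaceRank_lines_insert, habc]
    rw [hd]
    refine add_mem (add_mem ?_ ?_) ?_ <;> apply subset_span
    · exact ⟨a, by simp, ha⟩
    · exact ⟨b, by simp, hb⟩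
    · exact ⟨c, by simp, hc⟩
  have habp : subspaceRank (fun i => span F {v i}) {a, b, p} ≤ 2 :=
    subspaceRank_lines_collinear (mem_span_pair.2 ⟨1, 1, by simp [ha, hb, hp]⟩)
  have hbcq : subspaceRank (fun i => span F {v i}) {b, c, q} ≤ 2 :=
    subspaceRank_lines_collinear (mem_span_pair.2 ⟨1, 1, by simp [hb, hc, hq]⟩)
  have hacr : subspaceRank (fun i => span F {v i}) {a, c, r} ≤ 2 :=
    subspaceRank_lines_collinear (mem_span_pair.2 ⟨1, 1, by simp [ha, hc, hr]⟩)
  have hdcp : subspaceRank (fun i => span F {v i}) {d, c, p} ≤ 2 :=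
    subspaceRank_lines_collinear (mem_span_pair.2 ⟨1, -1, by rw [hd, hc, hp]; module⟩)
  have hdaq : subspaceRank (fun i => span F {v i}) {d, a, q} ≤ 2 :=
    subspaceRank_lines_collinear (mem_span_pair.2 ⟨1, -1, by rw [hd, ha, hq]; module⟩)
  have hdbr : subspaceRank (fun i => span F {v i}) {d, b, r} ≤ 2 :=
    subspaceRank_lines_collinear (mem_span_pair.2 ⟨1, -1, by rw [hd, hb, hr]; module⟩)
  rw [tripleBound, sa, sb, sc, sd, sp, sq, sr, habc, habcd]
  linarith

theorem overlap_lines_le_zero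
    (h : ∀ s t : F, s • v a + t • v b = 0 → s = 0 ∧ t = 0) :
    overlap (subspaceRank fun i => span F {v i}) a b ≤ 0 := by
  have hM := isMatroid_subspaceRank_span_singleton (F := F) v
  have ha := hM.le_card {a}
  have hb := hM.le_card {b}
  rw [Finset.card_singleton, Nat.cast_one] at ha hb
  rw [overlap, subspaceRank_lines_pair h]
  linarith

/-- As `2y = 0`, the lines `p, q, r` have rank at most `2`, and the gap is at most `2 + 3 - 3 - 3 =
-1`. -/
theorem oddGap_lines_neg [CharP F 2]
    (hind : ∀ r s t : F, r • x + s • y + t • z = 0 → r = 0 ∧ s = 0 ∧ t = 0)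
    (ha : v a = x) (hb : v b = y) (hc : v c = z) (hd : v d = x + y + z) (hp : v p = x + y)
    (hq : v q = y + z) (hr : v r = x + z) :
    oddGap (subspaceRank fun i => span F {v i}) a b c d p q r < 0 := by
  have hM := isMatroid_subspaceRank_span_singleton (F := F) v
  have ht := one_le_tripleBound_lines hind ha hb hc hd hp hq hr
  have sa := hM.le_card {a}
  have sb := hM.le_card {b}
  have sc := hM.le_card {c}
  rw [Finset.card_singleton, Nat.cast_one] at sa sb sc
  have habc : subspaceRank (fun i => span F {v i}) {a, b, c} = 3 :=
    subspaceRank_lines_triple (by rwa [ha, hb, hc])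
  have hpqr : subspaceRank (fun i => span F {v i}) {p, q, r} ≤ 2 := by
    refine subspaceRank_lines_collinear (mem_span_pair.2 ⟨1, 1, ?_⟩)
    have h2 : y + y = 0 := by rw [← two_smul F, CharTwo.two_eq_zero, zero_smul]
    rw [hp, hq, hr, one_smul, one_smul, add_assoc, ← add_assoc y, h2, zero_add]
  have o₁ : overlap (subspaceRank fun i => span F {v i}) b p ≤ 0 :=
    overlap_lines_le_zero fun s t h => by
      rw [hb, hp] at h
      have := hind t (s + t) 0 (by rw [← h]; module)
      grind
  have o₂ : overlap (subspaceRank fun i => span F {v i}) c r ≤ 0 :=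
    overlap_lines_le_zero fun s t h => by
      rw [hc, hr] at h
      have := hind t 0 (s + t) (by rw [← h]; module)
      grind
  have o₃ : overlap (subspaceRank fun i => span F {v i}) a p ≤ 0 :=
    overlap_lines_le_zero fun s t h => by
      rw [ha, hp] at h
      have := hind (s + t) t 0 (by rw [← h]; module)
      grind
  have o₄ : overlap (subspaceRank fun i => span F {v i}) c q ≤ 0 :=
    overlap_lines_le_zero fun s t h => by
      rw [hc, hq] at h
      have := hind 0 t (s + t) (by rw [← h]; module)
      grind
  have o₅ : overlap (subspaceRank fun i => span F {v i}) a r ≤ 0 :=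
    overlap_lines_le_zero fun s t h => by
      rw [ha, hr] at h
      have := hind (s + t) 0 t (by rw [← h]; module)
      grind
  have o₆ : overlap (subspaceRank fun i => span F {v i}) b q ≤ 0 :=
    overlap_lines_le_zero fun s t h => by
      rw [hb, hq] at h
      have := hind 0 (s + t) t (by rw [← h]; module)
      grind
  rw [oddGap]
  linarith

/-- With `2` invertible, `p, q, r` are independent, and the gap is at most `1 + 2 - 3 - 1 = -1`. -/
theorem evenGap_lines_neg (h2 : (2 : F) ≠ 0)
    (hind : ∀ r s t : F, r • x + s • y + t • z = 0 → r = 0 ∧ s = 0 ∧ t = 0)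
    (ha : v a = x) (hb : v b = y) (hc : v c = z) (hd : v d = x + y + z) (hp : v p = x + y)
    (hq : v q = y + z) (hr : v r = x + z) :
    evenGap (subspaceRank fun i => span F {v i}) a b c d p q r < 0 := by
  have hM := isMatroid_subspaceRank_span_singleton (F := F) v
  have ht := one_le_tripleBound_lines hind ha hb hc hd hp hq hr
  have sr := hM.le_card {r}
  rw [Finset.card_singleton, Nat.cast_one] at sr
  have hpq : subspaceRank (fun i => span F {v i}) {p, q} ≤ 2 :=
    (hM.le_card _).trans (by exact_mod_cast Finset.card_le_two)
  have hpqr : subspaceRank (fun i => span F {v i}) {p, q, r} = 3 :=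
    subspaceRank_lines_triple fun i j k h => by
      rw [hp, hq, hr] at h
      obtain ⟨h₁, h₂, h₃⟩ := hind (i + k) (i + j) (j + k) (by rw [← h]; module)
      have hi : 2 * i = 0 := by linear_combination h₁ + h₂ - h₃
      have hi := (mul_eq_zero.1 hi).resolve_left h2
      subst hi
      exact ⟨rfl, by simpa using h₂, by simpa using h₁⟩
  have o₁ : overlap (subspaceRank fun i => span F {v i}) a c ≤ 0 :=
    overlap_lines_le_zero fun s t h => by
      rw [ha, hc] at h
      have := hind s 0 t (by rw [← h]; module)
      grind
  have o₂ : overlap (subspaceRank fun i => span F {v i}) b d ≤ 0 :=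
    overlap_lines_le_zero fun s t h => by
      rw [hb, hd] at h
      have := hind t (s + t) t (by rw [← h]; module)
      grind
  rw [evenGap]
  linarith

end Frame

theorem exists_card_eq_prime_pow (F : Type*) [Field F] [Finite F] (p : ℕ) [CharP F p] :
    ∃ m : ℕ, p.Prime ∧ 0 < m ∧ Nat.card F = p ^ m := by
  have := Fintype.ofFinite F
  obtain ⟨m, hp, hm⟩ := FiniteField.card F p
  exact ⟨m, hp, m.pos, by rw [Nat.card_eq_fintype_card, hm]⟩

end SubspaceRank

open SubspaceRank in
theorem mainTheorem3 :
    (∀ (F : Type*) [Field F] [Finite F] [CharP F 2]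
        (W : Type*) [AddCommGroup W] [Module F W]
        (u : Fin 3 → W), LinearIndependent F u →
      SubspaceRank.IsMatroid (SubspaceRank.Φ₁ F u) ∧
      SubspaceRank.IsEvenRepresentable (SubspaceRank.Φ₁ F u) ∧
      ¬ SubspaceRank.IsAlmostOddRepresentable (SubspaceRank.Φ₁ F u)) ∧
    (∀ (F : Type*) [Field F] [Finite F] (p : ℕ) [CharP F p], Odd p →
      ∀ (W : Type*) [AddCommGroup W] [Module F W]
        (u : Fin 5 → W), LinearIndependent F u →
      SubspaceRank.IsMatroid (SubspaceRank.Φ₂ F u) ∧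
      SubspaceRank.IsOddRepresentable (SubspaceRank.Φ₂ F u) ∧
      ¬ SubspaceRank.IsAlmostEvenRepresentable (SubspaceRank.Φ₂ F u)) := by
  refine ⟨fun F _ _ _ W _ _ u hu => ⟨isMatroid_subspaceRank_span_singleton _, ?_, fun h => ?_⟩,
    fun F _ _ p _ hodd W _ _ u hu => ⟨isMatroid_subspaceRank_span_singleton _, ?_, fun h => ?_⟩⟩
  · obtain ⟨m, -, hm, hcard⟩ := exists_card_eq_prime_pow F 2
    exact ⟨m, hm, hcard ▸ isQRepresentable_subspaceRank _⟩
  · refine (h.oddGap_nonneg (.inl 0) (.inl 1) (.inl 2) (.inr 2) (.inr 0) (.inr 1) (.inr 3)).not_gt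
      (oddGap_lines_neg (x := u 0) (y := u 1) (z := u 2) (fun r s t h0 => ?_)
        rfl rfl rfl rfl rfl rfl rfl)
    have := Fintype.linearIndependent_iff.1 hu ![r, s, t] (by simpa [Fin.sum_univ_three] using h0)
    exact ⟨this 0, this 1, this 2⟩
  · obtain ⟨m, hp, hm, hcard⟩ := exists_card_eq_prime_pow F p
    exact ⟨p, m, hp, hodd, hm, hcard ▸ isQRepresentable_subspaceRank _⟩
  · have h2 : (2 : F) ≠ 0 := Ring.two_ne_zero fun hchar => by
      rw [← CharP.eq F ‹CharP F p› (ringChar.charP F)] at hchar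
      exact absurd (hchar ▸ hodd) (by decide)
    -- Seven of the thirteen lines suffice: those spanned by `u 0, u 1, u 2` and their sums.
    refine (h.evenGap_nonneg (.inl 0) (.inl 1) (.inl 2) (.inr 0) (.inr 2) (.inr 4) (.inr 3)).not_gt
      (evenGap_lines_neg h2 (x := u 0) (y := u 1) (z := u 2) (fun r s t h0 => ?_)
        rfl rfl rfl rfl rfl rfl rfl)
    have := Fintype.linearIndependent_iff.1 hu ![r, s, t, 0, 0]
      (by simpa [Fin.sum_univ_five] using h0)
    exact ⟨this 0, this 1, this 2⟩
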